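/- Let $\mathcal C$ be a category with pullbacks and with coequalizers of reflexive pairs (parallel pairs admitting a common section), and assume that these coequalizers are stable under pullback: pulling back the coequalizer diagram $X\rightrightarrows Y\to Q$ of a reflexive pair along any morphism $Q'\to Q$ gives again a coequalizer diagram. Let $\mathbb T=(T,\eta,\mu)$ be a monad on $\mathcal C$ whose endofunctor $T$ preserves coequalizers of reflexive pairs. A $\mathbb T$-category $A$ (Burroni) consists of objects $A_0,A_1$ and morphisms $d_0:A_1\to TA_0$, $c_0:A_1\to A_0$, $i:A_0\to A_1$, $m:A_2\to A_1$, where $A_2=TA_1\times_{TA_0}A_1$ is the pullback of $Tc_0$ and $d_0$, with projections $d_1:A_2\to TA_1$, $c_1:A_2\to A_1$, such that $$d_0 i=\eta_{A_0},\quad c_0 i=1,\quad d_0 m=\mu_{A_0}\cdot Td_0\cdot d_1,\quad c_0 m=c_0 c_1,$$ $$m\cdot (Ti\times 1)=1_{A_1}=m\cdot(\eta_{A_1}\times i),\qquad m\cdot (Tm\times c_1)=m\cdot((\mu_{A_1}\cdot Td_1)\times m).$$ Here $Ti\times 1,\ \eta_{A_1}\times i:A_1\to A_2$ have components $(Ti\cdot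 d_0,\,1)$ and $(\eta_{A_1},\,i\cdot c_0)$; further, $A_3=TA_2\times_{TA_1}A_2$ is the pullback of $Tc_1$ and $d_1$, with projections $d_2,c_2$, and $Tm\times c_1,\ (\mu_{A_1}\cdot Td_1)\times m:A_3\to A_2$ have components $(Tm\cdot d_2,\,c_1c_2)$ and $(\mu_{A_1}\cdot Td_1\cdot d_2,\,m\cdot c_2)$. A $\mathbb T$-functor $f:A\to B$ is a pair $f_0:A_0\to B_0$, $f_1:A_1\to B_1$ with $d_0f_1=Tf_0\cdot d_0$, $c_0f_1=f_0c_0$, $f_1 i=i f_0$ and $f_1m=m\cdot (Tf_1\times f_1)$. It is perfect (a discrete cofibration) if the square $d_0^B\cdot f_1=Tf_0\cdot d_0^A$ is a pullback in $\mathcal C$. Let $\mathsf{Cat}(\mathbb T)$ be the category of $\mathbb T$-categories and $\mathbb T$-functors, and for a $\mathbb T$-category $B$ let $\mathsf{Perf}(\mathbb T)/B$ be the full subcategory of the slice category $\mathsf{Cat}(\mathbb T)/B$ whose objects are the perfect $\mathbb T$-functors with codomain $B$. **Theorem.** For every $\mathbb T$-category $B$, the full subcategory $\mathsf{Perf}(\mathbb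 T)/B$ is reflective in $\mathsf{Cat}(\mathbb T)/B$, that is, its inclusion functor has a left adjoint. Moreover, the reflection of a $\mathbb T$-functor $f:A\to B$, given by a perfect $p:P\to B$ and the unit $r:A\to P$ with $p\cdot r=f$, satisfies the following. There is a coequalizer $z:TA_0\times_{TB_0}B_1\to P_0$ of the morphisms $$k=(\mu_{A_0}\cdot Td_0^A\cdot\pi_1',\; m^B\cdot(Tf_1\times 1_{B_1})),\qquad \ell=Tc_0^A\times 1_{B_1}\;:\; TA_1\times_{TB_0}B_1\rightrightarrows TA_0\times_{TB_0}B_1$$ such that $p_0\cdot z=c_0^B\cdot\pi_2$ and $r_0=z\cdot(\eta_{A_0},\,i^B\cdot f_0)$. Here the two pullbacks are those of $d_0^B$ along $T(f_0\cdot c_0^A)$ and along $Tf_0$; $\pi_1':TA_1\times_{TB_0}B_1\to TA_1$ and $\pi_2:TA_0\times_{TB_0}B_1\to B_1$ are projections; and $Tf_1\times 1_{B_1}:TA_1\times_{TB_0}B_1\to TB_1\times_{TB_0}B_1=B_2$. -/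

import Mathlib

open CategoryTheory CategoryTheory.Limits

universe v u

/-- Coequalizers of reflexive pairs are stable under pullback: if `q : Y ⟶ Q` is a coequalizer of
the reflexive pair `f, g : X ⟶ Y`, and the whole diagram is pulled back along some `h : Q' ⟶ Q`
(with `Y' = Y ×_Q Q'`, `X' = X ×_Q Q'` and the induced `f', g' : X' ⟶ Y'`), then the projection
`q' : Y' ⟶ Q'` is a coequalizer of `f', g'`. -/
def ReflexiveCoequalizersStable (C : Type u) [Category.{v} C] : Prop :=
  ∀ ⦃X Y Q X' Y' Q' : C⦄ (f g : X ⟶ Y) (q : Y ⟶ Q) (h : Q' ⟶ Q)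
    (x : X' ⟶ X) (y : Y' ⟶ Y) (f' g' : X' ⟶ Y') (q' : Y' ⟶ Q')
    (w : f ≫ q = g ≫ q) (w' : f' ≫ q' = g' ≫ q'),
    IsReflexivePair f g →
    Nonempty (IsColimit (Cofork.ofπ q w)) →
    IsPullback y q' q h →
    IsPullback x (f' ≫ q') (f ≫ q) h →
    f' ≫ y = x ≫ f →
    g' ≫ y = x ≫ g →
    Nonempty (IsColimit (Cofork.ofπ q' w'))

section

variable {C : Type u} [Category.{v} C]

/-- A `T`-graph: a span `T A₀ ⟵ A₁ ⟶ A₀`. -/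
structure TGraph (T : Monad C) where
  A₀ : C
  A₁ : C
  d₀ : A₁ ⟶ T.obj A₀
  c₀ : A₁ ⟶ A₀

namespace TGraph

variable {T : Monad C}

/-- Morphisms of `T`-graphs. -/
@[ext]
structure Hom (A B : TGraph T) where
  f₀ : A.A₀ ⟶ B.A₀
  f₁ : A.A₁ ⟶ B.A₁
  w_d : f₁ ≫ B.d₀ = A.d₀ ≫ T.map f₀
  w_c : f₁ ≫ B.c₀ = A.c₀ ≫ f₀

variable [HasPullbacks C]

/-- The object of composable pairs, `A₂ = T A₁ ×_{T A₀} A₁`. -/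
noncomputable def A₂ (A : TGraph T) : C := pullback (T.map A.c₀) A.d₀

noncomputable def d₁ (A : TGraph T) : A.A₂ ⟶ T.obj A.A₁ := pullback.fst _ _

noncomputable def c₁ (A : TGraph T) : A.A₂ ⟶ A.A₁ := pullback.snd _ _

theorem w₂ (A : TGraph T) : A.d₁ ≫ T.map A.c₀ = A.c₁ ≫ A.d₀ := pullback.condition

/-- The morphism into `A₂` with given components. -/
noncomputable def lift₂ (A : TGraph T) {X : C} (a : X ⟶ T.obj A.A₁) (b : X ⟶ A.A₁)
    (h : a ≫ T.map A.c₀ = b ≫ A.d₀) : X ⟶ A.A₂ := pullback.lift a b h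

@[simp]
theorem lift₂_d₁ (A : TGraph T) {X : C} (a : X ⟶ T.obj A.A₁) (b : X ⟶ A.A₁)
    (h : a ≫ T.map A.c₀ = b ≫ A.d₀) : A.lift₂ a b h ≫ A.d₁ = a := pullback.lift_fst _ _ _

@[simp]
theorem lift₂_c₁ (A : TGraph T) {X : C} (a : X ⟶ T.obj A.A₁) (b : X ⟶ A.A₁)
    (h : a ≫ T.map A.c₀ = b ≫ A.d₀) : A.lift₂ a b h ≫ A.c₁ = b := pullback.lift_snd _ _ _

theorem hom_ext₂ (A : TGraph T) {X : C} {a b : X ⟶ A.A₂} (hd : a ≫ A.d₁ = b ≫ A.d₁)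
    (hc : a ≫ A.c₁ = b ≫ A.c₁) : a = b := pullback.hom_ext hd hc

/-- The object of composable triples, `A₃ = T A₂ ×_{T A₁} A₂`. -/
noncomputable def A₃ (A : TGraph T) : C := pullback (T.map A.c₁) A.d₁

noncomputable def d₂ (A : TGraph T) : A.A₃ ⟶ T.obj A.A₂ := pullback.fst _ _

noncomputable def c₂ (A : TGraph T) : A.A₃ ⟶ A.A₂ := pullback.snd _ _

theorem w₃ (A : TGraph T) : A.d₂ ≫ T.map A.c₁ = A.c₂ ≫ A.d₁ := pullback.condition

/-- The morphism `f₂ = T f₁ × f₁ : A₂ ⟶ B₂`. -/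
noncomputable def Hom.f₂ {A B : TGraph T} (f : Hom A B) : A.A₂ ⟶ B.A₂ :=
  B.lift₂ (A.d₁ ≫ T.map f.f₁) (A.c₁ ≫ f.f₁) (by
    rw [Category.assoc, ← T.map_comp, f.w_c, T.map_comp, ← Category.assoc, A.w₂,
      Category.assoc, Category.assoc, f.w_d])

@[simp]
theorem Hom.f₂_d₁ {A B : TGraph T} (f : Hom A B) : f.f₂ ≫ B.d₁ = A.d₁ ≫ T.map f.f₁ :=
  B.lift₂_d₁ _ _ _

@[simp]
theorem Hom.f₂_c₁ {A B : TGraph T} (f : Hom A B) : f.f₂ ≫ B.c₁ = A.c₁ ≫ f.f₁ :=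
  B.lift₂_c₁ _ _ _

end TGraph

/-- A pointed `T`-graph: a `T`-graph with an insertion of identities `i : A₀ ⟶ A₁`. -/
structure PointedTGraph (T : Monad C) extends TGraph T where
  i : A₀ ⟶ A₁
  i_d₀ : i ≫ d₀ = T.η.app A₀
  i_c₀ : i ≫ c₀ = 𝟙 A₀

namespace PointedTGraph

variable [HasPullbacks C] {T : Monad C}

/-- `i₁ = T i × 1 : A₁ ⟶ A₂`. -/
noncomputable def i₁ (A : PointedTGraph T) : A.A₁ ⟶ A.A₂ :=
  A.lift₂ (A.d₀ ≫ T.map A.i) (𝟙 _) (by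
    rw [Category.assoc, ← T.map_comp, A.i_c₀, T.map_id, Category.comp_id, Category.id_comp])

/-- `i₂ = η × i : A₁ ⟶ A₂`. -/
noncomputable def i₂ (A : PointedTGraph T) : A.A₁ ⟶ A.A₂ :=
  A.lift₂ (T.η.app A.A₁) (A.c₀ ≫ A.i) (by
    rw [Category.assoc, A.i_d₀]; exact (T.η.naturality A.c₀).symm)

end PointedTGraph

/-- A pointed `T`-graph with a composition `m : A₂ ⟶ A₁` compatible with domains and codomains. -/
structure TMultGraph [HasPullbacks C] (T : Monad C) extends PointedTGraph T where
  m : toTGraph.A₂ ⟶ A₁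
  m_d₀ : m ≫ d₀ = toTGraph.d₁ ≫ T.map d₀ ≫ T.μ.app A₀
  m_c₀ : m ≫ c₀ = toTGraph.c₁ ≫ c₀

namespace TMultGraph

variable [HasPullbacks C] {T : Monad C}

/-- `m₁ = T m × c₁ : A₃ ⟶ A₂`. -/
noncomputable def m₁ (A : TMultGraph T) : A.A₃ ⟶ A.A₂ :=
  A.lift₂ (A.d₂ ≫ T.map A.m) (A.c₂ ≫ A.c₁) (by
    rw [Category.assoc, ← T.map_comp, A.m_c₀, T.map_comp, ← Category.assoc, A.w₃,
      Category.assoc, Category.assoc, A.w₂])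

/-- `m₂ = (μ · T d₁) × m : A₃ ⟶ A₂`. -/
noncomputable def m₂ (A : TMultGraph T) : A.A₃ ⟶ A.A₂ :=
  A.lift₂ (A.d₂ ≫ T.map A.d₁ ≫ T.μ.app A.A₁) (A.c₂ ≫ A.m) (by
    have h : T.μ.app A.A₁ ≫ T.map A.c₀ = T.map (T.map A.c₀) ≫ T.μ.app A.A₀ :=
      (T.μ.naturality A.c₀).symm
    have h' : T.map A.d₁ ≫ T.map (T.map A.c₀) = T.map A.c₁ ≫ T.map A.d₀ := by
      rw [← T.map_comp, A.w₂, T.map_comp]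
    simp only [Category.assoc, h, A.m_d₀]
    rw [reassoc_of% h', reassoc_of% A.w₃])

end TMultGraph

/-- A `T`-category (Burroni). -/
structure TCat [HasPullbacks C] (T : Monad C) extends TMultGraph T where
  i₁_m : toPointedTGraph.i₁ ≫ m = 𝟙 A₁
  i₂_m : toPointedTGraph.i₂ ≫ m = 𝟙 A₁
  assoc : toTMultGraph.m₁ ≫ m = toTMultGraph.m₂ ≫ m

namespace TCat

variable [HasPullbacks C] {T : Monad C}

/-- A `T`-functor. -/
@[ext]
structure Hom (A B : TCat T) extends TGraph.Hom A.toTGraph B.toTGraph where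
  w_i : A.i ≫ f₁ = f₀ ≫ B.i
  w_m : A.m ≫ f₁ = toHom.f₂ ≫ B.m

/-- The category `Cat(T)` of `T`-categories and `T`-functors. -/
noncomputable instance : Category (TCat T) where
  Hom A B := Hom A B
  id A :=
    { f₀ := 𝟙 _
      f₁ := 𝟙 _
      w_d := by simp
      w_c := by simp
      w_i := by simp
      w_m := by
        rw [Category.comp_id]
        refine (Category.id_comp _).symm.trans (congrArg (· ≫ A.m) ?_)
        apply TGraph.hom_ext₂ <;> simp }
  comp {A B D} f g :=
    { f₀ := f.f₀ ≫ g.f₀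
      f₁ := f.f₁ ≫ g.f₁
      w_d := by rw [Category.assoc, g.w_d, ← Category.assoc, f.w_d, Category.assoc, T.map_comp]
      w_c := by rw [Category.assoc, g.w_c, ← Category.assoc, f.w_c, Category.assoc]
      w_i := by rw [← Category.assoc, f.w_i, Category.assoc, g.w_i, Category.assoc]
      w_m := by
        rw [← Category.assoc, f.w_m, Category.assoc, g.w_m, ← Category.assoc]
        refine congrArg (· ≫ D.m) ?_
        apply TGraph.hom_ext₂
        · rw [TGraph.Hom.f₂_d₁, Category.assoc, TGraph.Hom.f₂_d₁, ← Category.assoc,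
            TGraph.Hom.f₂_d₁, Category.assoc, ← T.map_comp]
        · rw [TGraph.Hom.f₂_c₁, Category.assoc, TGraph.Hom.f₂_c₁, ← Category.assoc,
            TGraph.Hom.f₂_c₁, Category.assoc] }
  id_comp f := Hom.ext (Category.id_comp _) (Category.id_comp _)
  comp_id f := Hom.ext (Category.comp_id _) (Category.comp_id _)
  assoc f g h := Hom.ext (Category.assoc _ _ _) (Category.assoc _ _ _)

/-- The morphism of `T`-graphs underlying a `T`-functor. -/
abbrev toGraphHom {A B : TCat T} (f : A ⟶ B) : TGraph.Hom A.toTGraph B.toTGraph :=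
  TCat.Hom.toHom f

/-- The object part `f₀ : A₀ ⟶ B₀` of a `T`-functor. -/
abbrev ob {A B : TCat T} (f : A ⟶ B) : A.A₀ ⟶ B.A₀ := (toGraphHom f).f₀

/-- The morphism part `f₁ : A₁ ⟶ B₁` of a `T`-functor. -/
abbrev mor {A B : TCat T} (f : A ⟶ B) : A.A₁ ⟶ B.A₁ := (toGraphHom f).f₁

/-- The class `Perf(T)` of perfect `T`-functors (discrete cofibrations): those `f : A ⟶ B` for
which `T A₀ ⟵ A₁ ⟶ B₁` exhibits `A₁` as the pullback `T A₀ ×_{T B₀} B₁`. -/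
def Perf (T : Monad C) : MorphismProperty (TCat T) :=
  fun A B f => IsPullback A.d₀ (mor f) (T.map (ob f)) B.d₀

/-- The objects of `Cat(T)/B` that are perfect `T`-functors. -/
def PerfOver (B : TCat T) : ObjectProperty (Over B) := fun X => Perf T X.hom

section Presentation

variable {A B : TCat T} (f : A ⟶ B)

/-- `T A₀ ×_{T B₀} B₁`. -/
noncomputable abbrev Obj₀ : C := pullback (T.map (ob f)) B.d₀

/-- `T A₁ ×_{T B₀} B₁`, formed along `T (f₀ · c₀) : T A₁ ⟶ T B₀`. -/
noncomputable abbrev Obj₁ : C := pullback (T.map (A.c₀ ≫ ob f)) B.d₀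

/-- `T f₁ × 1 : T A₁ ×_{T B₀} B₁ ⟶ T B₁ ×_{T B₀} B₁ = B₂`. -/
noncomputable def toB₂ : Obj₁ f ⟶ B.A₂ :=
  B.lift₂ (pullback.fst _ _ ≫ T.map (mor f)) (pullback.snd _ _) (by
    rw [Category.assoc, ← T.map_comp, (toGraphHom f).w_c, pullback.condition])

/-- `k = (μ · T d₀ · π₁', m · (T f₁ × 1))`. -/
noncomputable def k : Obj₁ f ⟶ Obj₀ f :=
  pullback.lift (pullback.fst _ _ ≫ T.map A.d₀ ≫ T.μ.app A.A₀) (toB₂ f ≫ B.m) (by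
    have h : T.μ.app A.A₀ ≫ T.map (ob f) = T.map (T.map (ob f)) ≫ T.μ.app B.A₀ :=
      (T.μ.naturality (ob f)).symm
    have h' : T.map A.d₀ ≫ T.map (T.map (ob f)) = T.map (mor f) ≫ T.map B.d₀ := by
      rw [← T.map_comp, ← T.map_comp, (toGraphHom f).w_d]
    have h'' : toB₂ f ≫ B.d₁ = pullback.fst _ _ ≫ T.map (mor f) := by simp [toB₂]
    simp only [Category.assoc, h, B.m_d₀]
    rw [reassoc_of% h', reassoc_of% h''])

/-- `ℓ = T c₀ × 1`. -/
noncomputable def l : Obj₁ f ⟶ Obj₀ f :=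
  pullback.lift (pullback.fst _ _ ≫ T.map A.c₀) (pullback.snd _ _) (by
    rw [Category.assoc, ← T.map_comp, pullback.condition])

/-- `e = η × (i · f₀) : A₀ ⟶ T A₀ ×_{T B₀} B₁`. -/
noncomputable def e : A.A₀ ⟶ Obj₀ f :=
  pullback.lift (T.η.app A.A₀) (ob f ≫ B.i) (by
    rw [Category.assoc, B.i_d₀]; exact (T.η.naturality (ob f)).symm)

end Presentation

end TCat

end

/-!
For a fixed `T`-category `B`, the assignment sending `p : X ⟶ B₀` to `T X ×_{T B₀} B₁`, with
structure map the codomain of the `B₁`-component, is a monad on objects over `B₀` (`TCat.ext`, with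
unit `extUnit` and multiplication `extMul`); its laws come from the monad laws of `T` and the
category laws of `B`. Its algebras are the actions of `B`, and these are the same thing as perfect
`T`-functors into `B`: an action has a `T`-category of elements, perfect over `B`
(`ExtAlgebra.toTCat`, `ExtAlgebra.proj_perf`), and a perfect `q : Q ⟶ B` carries the action
`T Q₀ ×_{T B₀} B₁ ≅ Q₁ ⟶ Q₀` (`act`). Moreover a `T`-functor over `B` from `f : A ⟶ B` to a perfect
`q` is the same as a morphism `g : A₀ ⟶ Q₀` over `B₀` for which the arrows of `A` act as their
images in `B` do (`cmp_extMap_act`, `homOfOb`, `hom_ext_of_perf`). In terms of actions, that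
condition says that the extension of `g` to the free action on `A₀` identifies the two morphisms
`k` and `l` from the free action on `A₁`. So the reflection of `f` is the coequalizer of `k` and `l`
in the category of actions.

The pair `k, l` is reflexive, with section induced by `i : A₀ ⟶ A₁`. Because `T` preserves reflexive
coequalizers and these are stable under pullback, the monad preserves them
(`extMap_isColimit`), so the coequalizer of `k` and `l` in the base category inherits an action
(`reflAlgebra`) and is the coequalizer of actions (`reflDesc`, `eq_reflDesc`).
-/

/-! ### The free action monad of a `T`-category -/

namespace TCat

section Ext

variable {C : Type u} [Category.{v} C] [HasPullbacks C] {T : Monad C} (B : TCat T)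

/-- The free `B`-action `T X ×_{T B₀} B₁` on an object `p : X ⟶ B₀` over `B₀`. For `p = f₀` and
`p = c₀ ≫ f₀` this is `Obj₀ f` and `Obj₁ f`. -/
noncomputable abbrev ext {X : C} (p : X ⟶ B.A₀) : C := pullback (T.map p) B.d₀

/-- The structure map of the free `B`-action over `B₀`: the codomain of the `B₁`-component. -/
noncomputable abbrev extHom {X : C} (p : X ⟶ B.A₀) : B.ext p ⟶ B.A₀ :=
  pullback.snd (T.map p) B.d₀ ≫ B.c₀

/-- Functoriality of the free `B`-action on morphisms over `B₀`. The target structure map is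
a separate argument, tied to the source one by `h`, so that equal structure maps need not be
syntactically equal. -/
noncomputable def extMap {X Y : C} {p : X ⟶ B.A₀} {q : Y ⟶ B.A₀} (u : X ⟶ Y) (h : u ≫ q = p) :
    B.ext p ⟶ B.ext q :=
  pullback.lift (pullback.fst _ _ ≫ T.map u) (pullback.snd _ _) (by
    rw [Category.assoc, ← T.map_comp, h, pullback.condition])

/-- The unit `(η, i · p)` of the monad `B.ext` on objects over `B₀`. -/
noncomputable def extUnit {X : C} (p : X ⟶ B.A₀) : X ⟶ B.ext p :=
  pullback.lift (T.η.app X) (p ≫ B.i) (by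
    rw [Category.assoc, B.i_d₀]; exact (T.η.naturality p).symm)

/-- A pair consisting of an element of `T (T X ×_{T B₀} B₁)` and a compatible one of `B₁`, sent to
the composable pair of its components in `B`. -/
noncomputable def extToA₂ {X : C} (p : X ⟶ B.A₀) : B.ext (B.extHom p) ⟶ B.A₂ :=
  B.lift₂ (pullback.fst _ _ ≫ T.map (pullback.snd _ _)) (pullback.snd _ _) (by
    rw [Category.assoc, ← T.map_comp, pullback.condition])

/-- The multiplication of the monad `B.ext`: the multiplication of `T` on the `T X`-component and
the composition of `B` on the `B₁`-component. -/
noncomputable def extMul {X : C} (p : X ⟶ B.A₀) : B.ext (B.extHom p) ⟶ B.ext p :=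
  pullback.lift (pullback.fst _ _ ≫ T.map (pullback.fst _ _) ≫ T.μ.app X) (B.extToA₂ p ≫ B.m) (by
    have h : T.μ.app X ≫ T.map p = T.map (T.map p) ≫ T.μ.app B.A₀ := (T.μ.naturality p).symm
    have h' : T.map (pullback.fst (T.map p) B.d₀) ≫ T.map (T.map p) =
        T.map (pullback.snd (T.map p) B.d₀) ≫ T.map B.d₀ := by
      rw [← T.map_comp, pullback.condition, T.map_comp]
    have h'' : B.extToA₂ p ≫ B.d₁ = pullback.fst _ _ ≫ T.map (pullback.snd _ _) :=
      B.lift₂_d₁ _ _ _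
    simp only [Category.assoc, h, B.m_d₀]
    rw [reassoc_of% h', reassoc_of% h''])

section Projections

variable {X Y : C} {p : X ⟶ B.A₀} {q : Y ⟶ B.A₀} (u : X ⟶ Y) (h : u ≫ q = p)

theorem extMap_fst : B.extMap u h ≫ pullback.fst _ _ = pullback.fst _ _ ≫ T.map u :=
  pullback.lift_fst _ _ _

theorem extMap_snd : B.extMap u h ≫ pullback.snd _ _ = pullback.snd _ _ :=
  pullback.lift_snd _ _ _

variable (p) in
theorem extUnit_fst : B.extUnit p ≫ pullback.fst _ _ = T.η.app X := pullback.lift_fst _ _ _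

variable (p) in
theorem extUnit_snd : B.extUnit p ≫ pullback.snd _ _ = p ≫ B.i := pullback.lift_snd _ _ _

variable (p) in
theorem extToA₂_d₁ : B.extToA₂ p ≫ B.d₁ = pullback.fst _ _ ≫ T.map (pullback.snd _ _) :=
  B.lift₂_d₁ _ _ _

variable (p) in
theorem extToA₂_c₁ : B.extToA₂ p ≫ B.c₁ = pullback.snd _ _ := B.lift₂_c₁ _ _ _

variable (p) in
theorem extMul_fst : B.extMul p ≫ pullback.fst _ _ =
    pullback.fst _ _ ≫ T.map (pullback.fst _ _) ≫ T.μ.app X := pullback.lift_fst _ _ _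

variable (p) in
theorem extMul_snd : B.extMul p ≫ pullback.snd _ _ = B.extToA₂ p ≫ B.m := pullback.lift_snd _ _ _

variable (p) in
theorem extMul_extHom : B.extMul p ≫ B.extHom p = B.extHom (B.extHom p) := by
  rw [reassoc_of% @extMul_snd, B.m_c₀, reassoc_of% @extToA₂_c₁]

variable (p) in
theorem extUnit_extHom : B.extUnit p ≫ B.extHom p = p := by
  rw [reassoc_of% @extUnit_snd, B.i_c₀, Category.comp_id]

theorem extMap_extHom : B.extMap u h ≫ B.extHom q = B.extHom p := by
  rw [reassoc_of% @extMap_snd]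

end Projections

section MonadLaws

variable {X Y Z : C} {p : X ⟶ B.A₀} {q : Y ⟶ B.A₀} {r : Z ⟶ B.A₀}

theorem extMap_comp (u : X ⟶ Y) (h : u ≫ q = p) (w : Y ⟶ Z) (h' : w ≫ r = q) :
    B.extMap u h ≫ B.extMap w h' =
      B.extMap (u ≫ w) (by rw [Category.assoc, h', h]) := by
  apply pullback.hom_ext
  · simp only [Category.assoc, extMap_fst, reassoc_of% @extMap_fst, T.map_comp]
  · simp only [Category.assoc, extMap_snd]

theorem extMap_id (p : X ⟶ B.A₀) : B.extMap (𝟙 X) (Category.id_comp p) = 𝟙 _ := by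
  apply pullback.hom_ext
  · simp [extMap_fst]
  · simp [extMap_snd]

theorem extMap_congr {u u' : X ⟶ Y} (e : u = u') (h : u ≫ q = p) :
    B.extMap u h = B.extMap u' (e ▸ h) := by
  subst e; rfl

theorem extUnit_naturality (u : X ⟶ Y) (h : u ≫ q = p) :
    u ≫ B.extUnit q = B.extUnit p ≫ B.extMap u h := by
  apply pullback.hom_ext
  · simp only [Category.assoc, extMap_fst, extUnit_fst, reassoc_of% @extUnit_fst]
    exact T.η.naturality u
  · simp only [Category.assoc, extMap_snd, extUnit_snd, reassoc_of% h]

theorem extMul_naturality (u : X ⟶ Y) (h : u ≫ q = p) :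
    B.extMap (B.extMap u h) (B.extMap_extHom u h) ≫ B.extMul q = B.extMul p ≫ B.extMap u h := by
  apply pullback.hom_ext
  · have hμ : T.μ.app X ≫ T.map u = T.map (T.map u) ≫ T.μ.app Y := (T.μ.naturality u).symm
    simp only [Category.assoc, extMap_fst, reassoc_of% @extMap_fst, extMul_fst,
      reassoc_of% @extMul_fst, hμ]
    simp only [← T.map_comp_assoc, extMap_fst]
  · simp only [Category.assoc, extMap_snd, extMul_snd]
    rw [← Category.assoc]
    congr 1
    apply TGraph.hom_ext₂
    · simp only [Category.assoc, extToA₂_d₁, reassoc_of% @extMap_fst, ← T.map_comp, extMap_snd]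
    · simp only [Category.assoc, extToA₂_c₁, extMap_snd]

theorem extUnit_extMul (p : X ⟶ B.A₀) : B.extUnit (B.extHom p) ≫ B.extMul p = 𝟙 _ := by
  apply pullback.hom_ext
  · have hη : T.η.app (B.ext p) ≫ T.map (pullback.fst _ _) = pullback.fst _ _ ≫ T.η.app _ :=
      (T.η.naturality _).symm
    simp only [Category.assoc, extMul_fst, reassoc_of% @extUnit_fst, reassoc_of% hη,
      Category.id_comp]
    rw [T.left_unit]
    exact Category.comp_id _
  · have key : B.extUnit (B.extHom p) ≫ B.extToA₂ p = pullback.snd _ _ ≫ B.i₂ := by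
      have hη : T.η.app (B.ext p) ≫ T.map (pullback.snd _ _) = pullback.snd _ _ ≫ T.η.app _ :=
        (T.η.naturality _).symm
      apply TGraph.hom_ext₂
      · simp only [Category.assoc, extToA₂_d₁, reassoc_of% @extUnit_fst, hη, PointedTGraph.i₂,
          TGraph.lift₂_d₁]
      · simp only [Category.assoc, extToA₂_c₁, extUnit_snd, PointedTGraph.i₂, TGraph.lift₂_c₁]
    rw [Category.assoc, extMul_snd, reassoc_of% key, B.i₂_m, Category.comp_id, Category.id_comp]

theorem extMap_extUnit_extMul (p : X ⟶ B.A₀) :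
    B.extMap (B.extUnit p) (B.extUnit_extHom p) ≫ B.extMul p = 𝟙 _ := by
  apply pullback.hom_ext
  · simp only [Category.assoc, extMul_fst, reassoc_of% @extMap_fst, Category.id_comp,
      ← T.map_comp_assoc, extUnit_fst]
    rw [T.right_unit]
    exact Category.comp_id _
  · have key : B.extMap (B.extUnit p) (B.extUnit_extHom p) ≫ B.extToA₂ p =
        pullback.snd _ _ ≫ B.i₁ := by
      apply TGraph.hom_ext₂
      · simp only [Category.assoc, extToA₂_d₁, reassoc_of% @extMap_fst, PointedTGraph.i₁,
          TGraph.lift₂_d₁, ← T.map_comp, extUnit_snd]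
        rw [T.map_comp, pullback.condition_assoc]
      · simp only [Category.assoc, extToA₂_c₁, extMap_snd, PointedTGraph.i₁, TGraph.lift₂_c₁,
          Category.comp_id]
    rw [Category.assoc, extMul_snd, reassoc_of% key, B.i₁_m, Category.comp_id, Category.id_comp]

/-- A triple iterate of the free action, sent to the composable triple of its components in
`B`. -/
noncomputable def extToA₃ (p : X ⟶ B.A₀) : B.ext (B.extHom (B.extHom p)) ⟶ B.A₃ :=
  pullback.lift (pullback.fst _ _ ≫ T.map (B.extToA₂ p)) (B.extToA₂ (B.extHom p)) (by
    rw [Category.assoc, ← T.map_comp, extToA₂_c₁, extToA₂_d₁])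

theorem extToA₃_d₂ (p : X ⟶ B.A₀) :
    B.extToA₃ p ≫ B.d₂ = pullback.fst _ _ ≫ T.map (B.extToA₂ p) := pullback.lift_fst _ _ _

theorem extToA₃_c₂ (p : X ⟶ B.A₀) : B.extToA₃ p ≫ B.c₂ = B.extToA₂ (B.extHom p) :=
  pullback.lift_snd _ _ _

theorem extMul_assoc (p : X ⟶ B.A₀) :
    B.extMap (B.extMul p) (B.extMul_extHom p) ≫ B.extMul p =
      B.extMul (B.extHom p) ≫ B.extMul p := by
  apply pullback.hom_ext
  · have hμ : T.μ.app (B.ext p) ≫ T.map (pullback.fst _ _) =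
        T.map (T.map (pullback.fst _ _)) ≫ T.μ.app _ := (T.μ.naturality _).symm
    simp only [Category.assoc, extMul_fst, reassoc_of% @extMul_fst, reassoc_of% @extMap_fst,
      reassoc_of% hμ]
    rw [← T.assoc]
    simp only [← T.map_comp_assoc, extMul_fst]
  · have h₁ : B.extMap (B.extMul p) (B.extMul_extHom p) ≫ B.extToA₂ p = B.extToA₃ p ≫ B.m₁ := by
      apply TGraph.hom_ext₂
      · simp only [Category.assoc, extToA₂_d₁, reassoc_of% @extMap_fst, TMultGraph.m₁,
          TGraph.lift₂_d₁,
          reassoc_of% @extToA₃_d₂, ← T.map_comp, extMul_snd]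
      · simp only [Category.assoc, extToA₂_c₁, extMap_snd, TMultGraph.m₁, TGraph.lift₂_c₁,
          reassoc_of% @extToA₃_c₂]
    have h₂ : B.extMul (B.extHom p) ≫ B.extToA₂ p = B.extToA₃ p ≫ B.m₂ := by
      have hμ : T.μ.app (B.ext p) ≫ T.map (pullback.snd _ _) =
          T.map (T.map (pullback.snd _ _)) ≫ T.μ.app _ := (T.μ.naturality _).symm
      apply TGraph.hom_ext₂
      · simp only [Category.assoc, extToA₂_d₁, reassoc_of% @extMul_fst, TMultGraph.m₂,
          TGraph.lift₂_d₁,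
          reassoc_of% @extToA₃_d₂, hμ]
        simp only [← T.map_comp_assoc, extToA₂_d₁]
      · simp only [Category.assoc, extToA₂_c₁, extMul_snd, TMultGraph.m₂, TGraph.lift₂_c₁,
          reassoc_of% @extToA₃_c₂]
    rw [Category.assoc, extMul_snd, reassoc_of% h₁, B.assoc, Category.assoc, extMul_snd,
      reassoc_of% h₂]

end MonadLaws

/-- If reflexive coequalizers are stable under pullback and preserved by `T`, then the free
action preserves coequalizers of reflexive pairs over `B₀`. -/
theorem extMap_isColimit (hC : ReflexiveCoequalizersStable C)
    (hT : Monad.PreservesColimitOfIsReflexivePair T.toFunctor) {X Y Z : C}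
    {p : X ⟶ B.A₀} {q : Y ⟶ B.A₀} {r : Z ⟶ B.A₀} {f g : X ⟶ Y} (hfg : IsReflexivePair f g)
    {z : Y ⟶ Z} (w : f ≫ z = g ≫ z) (hz : Nonempty (IsColimit (Cofork.ofπ z w)))
    (hf : f ≫ q = p) (hg : g ≫ q = p) (hr : z ≫ r = q) :
    ∃ w' : B.extMap f hf ≫ B.extMap z hr = B.extMap g hg ≫ B.extMap z hr,
      Nonempty (IsColimit (Cofork.ofπ (B.extMap z hr) w')) := by
  have w' : B.extMap f hf ≫ B.extMap z hr = B.extMap g hg ≫ B.extMap z hr := by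
    simp only [extMap_comp, w]
  have hpb {V W : C} {a : V ⟶ B.A₀} {b : W ⟶ B.A₀} (t : V ⟶ W) (h : t ≫ b = a) :
      IsPullback (pullback.fst (T.map a) B.d₀) (B.extMap t h) (T.map t)
        (pullback.fst (T.map b) B.d₀) := by
    subst h
    refine (IsPullback.of_right (h₁₂ := pullback.snd (T.map b) B.d₀) (h₂₂ := T.map b)
      (v₁₃ := B.d₀) ?_ (B.extMap_fst t rfl) (IsPullback.of_hasPullback _ _).flip).flip
    rw [extMap_snd, ← T.map_comp]
    exact (IsPullback.of_hasPullback _ _).flip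
  refine ⟨w', ?_⟩
  have hTw : T.map f ≫ T.map z = T.map g ≫ T.map z := by simp only [← T.map_comp, w]
  have hpres := hT.out f g
  obtain ⟨hz⟩ := hz
  refine hC (T.map f) (T.map g) (T.map z) (pullback.fst (T.map r) B.d₀) (pullback.fst _ _)
    (pullback.fst _ _) _ _ _ hTw w' ?_
    ⟨isColimitCoforkMapOfIsColimit T.toFunctor w hz⟩ (hpb z hr) ?_
    (B.extMap_fst _ _) (B.extMap_fst _ _)
  · obtain ⟨s, hs, hs'⟩ := hfg.common_section'
    exact IsReflexivePair.mk' (T.map s) (by rw [← T.map_comp, hs, T.map_id])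
      (by rw [← T.map_comp, hs', T.map_id])
  · rw [extMap_comp, ← T.map_comp]
    exact hpb (f ≫ z) _

end Ext

end TCat

/-! ### The `T`-category of elements of an action -/

namespace TCat

variable {C : Type u} [Category.{v} C] [HasPullbacks C] {T : Monad C}

/-- A `B`-action: an algebra for the monad `B.ext` on objects over `B₀`. -/
structure ExtAlgebra (B : TCat T) where
  /-- The underlying object. -/
  X : C
  /-- The structure map to `B₀`. -/
  p : X ⟶ B.A₀
  /-- The action of `B` on `X`. -/
  a : B.ext p ⟶ X
  a_p : a ≫ p = B.extHom p
  unit : B.extUnit p ≫ a = 𝟙 X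
  assoc : B.extMap a a_p ≫ a = B.extMul p ≫ a

namespace ExtAlgebra

variable {B : TCat T} (P : ExtAlgebra B)

/-- The `T`-graph of elements of a `B`-action: its arrows are the elements of the free action, with
codomain given by the action. -/
noncomputable abbrev graph : TGraph T where
  A₀ := P.X
  A₁ := B.ext P.p
  d₀ := pullback.fst _ _
  c₀ := P.a

/-- Composable pairs in the `T`-graph of elements, as elements of the twice iterated free
action. -/
noncomputable def pair : P.graph.A₂ ⟶ B.ext (B.extHom P.p) :=
  pullback.lift P.graph.d₁ (P.graph.c₁ ≫ pullback.snd _ _) (by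
    rw [← P.a_p, T.map_comp, Category.assoc, ← pullback.condition]
    simpa using congrArg (· ≫ T.map P.p) P.graph.w₂)

theorem pair_fst : P.pair ≫ pullback.fst _ _ = P.graph.d₁ := pullback.lift_fst _ _ _

theorem pair_snd : P.pair ≫ pullback.snd _ _ = P.graph.c₁ ≫ pullback.snd _ _ :=
  pullback.lift_snd _ _ _

theorem pair_extMap : P.pair ≫ B.extMap P.a P.a_p = P.graph.c₁ := by
  apply pullback.hom_ext
  · rw [Category.assoc, extMap_fst, reassoc_of% @pair_fst]
    exact P.graph.w₂
  · rw [Category.assoc, extMap_snd, pair_snd]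

/-- The `T`-graph of elements with its identities and composition, given by the unit and the
multiplication of the monad `B.ext`. -/
noncomputable abbrev multGraph : TMultGraph T where
  toTGraph := P.graph
  i := B.extUnit P.p
  i_d₀ := B.extUnit_fst P.p
  i_c₀ := P.unit
  m := P.pair ≫ B.extMul P.p
  m_d₀ := by
    rw [Category.assoc, extMul_fst, reassoc_of% @pair_fst]
  m_c₀ := by
    rw [Category.assoc, ← P.assoc, reassoc_of% @pair_extMap]

theorem multGraph_m : P.multGraph.m = P.pair ≫ B.extMul P.p := rfl

/-- Composable triples in the `T`-graph of elements, as elements of the three times iterated free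
action. -/
noncomputable def triple : P.graph.A₃ ⟶ B.ext (B.extHom (B.extHom P.p)) :=
  pullback.lift (P.graph.d₂ ≫ T.map P.pair) (P.graph.c₂ ≫ P.pair ≫ pullback.snd _ _) (by
    rw [Category.assoc, ← T.map_comp, reassoc_of% @pair_snd, T.map_comp, reassoc_of% P.graph.w₃,
      Category.assoc, Category.assoc, ← pullback.condition, reassoc_of% @pair_fst])

theorem triple_fst : P.triple ≫ pullback.fst _ _ = P.graph.d₂ ≫ T.map P.pair :=
  pullback.lift_fst _ _ _

theorem triple_snd : P.triple ≫ pullback.snd _ _ = P.graph.c₂ ≫ P.pair ≫ pullback.snd _ _ :=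
  pullback.lift_snd _ _ _

theorem triple_extMap_extMul :
    P.triple ≫ B.extMap (B.extMul P.p) (B.extMul_extHom P.p) = P.multGraph.m₁ ≫ P.pair := by
  apply pullback.hom_ext
  · rw [Category.assoc, extMap_fst, reassoc_of% @triple_fst, Category.assoc, pair_fst, ← T.map_comp]
    exact (P.graph.lift₂_d₁ _ _ _).symm
  · rw [Category.assoc, extMap_snd, triple_snd, Category.assoc, pair_snd, ← Category.assoc,
      ← Category.assoc]
    exact congrArg (· ≫ pullback.snd _ _) (P.graph.lift₂_c₁ _ _ _).symm

theorem triple_extToA₂ : P.triple ≫ B.extToA₂ (B.extHom P.p) =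
    P.graph.c₂ ≫ P.pair ≫ B.extToA₂ P.p := by
  apply TGraph.hom_ext₂
  · rw [Category.assoc, extToA₂_d₁, reassoc_of% @triple_fst, ← T.map_comp, pair_snd, Category.assoc,
      Category.assoc, extToA₂_d₁, reassoc_of% @pair_fst, T.map_comp, reassoc_of% P.graph.w₃]
  · rw [Category.assoc, extToA₂_c₁, triple_snd, Category.assoc, Category.assoc, extToA₂_c₁]

theorem triple_extMul :
    P.triple ≫ B.extMul (B.extHom P.p) = P.multGraph.m₂ ≫ P.pair := by
  apply pullback.hom_ext
  · rw [Category.assoc, extMul_fst, reassoc_of% @triple_fst, Category.assoc, pair_fst,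
      ← T.map_comp_assoc, pair_fst]
    exact (P.graph.lift₂_d₁ _ _ _).symm
  · have h : P.multGraph.m₂ ≫ P.graph.c₁ = P.graph.c₂ ≫ P.pair ≫ B.extMul P.p :=
      P.graph.lift₂_c₁ _ _ _
    rw [Category.assoc, extMul_snd, reassoc_of% P.triple_extToA₂, Category.assoc, pair_snd,
      reassoc_of% h, extMul_snd]

/-- The `T`-category of elements of a `B`-action. -/
noncomputable def toTCat : TCat T where
  toTMultGraph := P.multGraph
  i₁_m := by
    have h : P.multGraph.i₁ ≫ P.pair = B.extMap (B.extUnit P.p) (B.extUnit_extHom P.p) := by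
      apply pullback.hom_ext
      · rw [Category.assoc, pair_fst, extMap_fst]
        exact P.graph.lift₂_d₁ _ _ _
      · have h' : P.multGraph.i₁ ≫ P.graph.c₁ = 𝟙 _ := P.graph.lift₂_c₁ _ _ _
        rw [Category.assoc, pair_snd, extMap_snd, reassoc_of% h']
    rw [multGraph_m, reassoc_of% h, extMap_extUnit_extMul]
  i₂_m := by
    have h : P.multGraph.i₂ ≫ P.pair = B.extUnit (B.extHom P.p) := by
      apply pullback.hom_ext
      · rw [Category.assoc, pair_fst, extUnit_fst]
        exact P.graph.lift₂_d₁ _ _ _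
      · have h' : P.multGraph.i₂ ≫ P.graph.c₁ = P.a ≫ B.extUnit P.p := P.graph.lift₂_c₁ _ _ _
        rw [Category.assoc, pair_snd, extUnit_snd, reassoc_of% h', extUnit_snd, ← P.a_p,
          Category.assoc]
    rw [multGraph_m, reassoc_of% h, extUnit_extMul]
  assoc := by
    rw [multGraph_m]
    rw [← Category.assoc, ← triple_extMap_extMul, ← Category.assoc, ← triple_extMul,
      Category.assoc, Category.assoc, extMul_assoc]

/-- The projection from the `T`-category of elements of a `B`-action to `B`. -/
noncomputable def proj : P.toTCat ⟶ B :=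
  show TCat.Hom _ _ from
  { f₀ := P.p
    f₁ := pullback.snd _ _
    w_d := pullback.condition.symm
    w_c := P.a_p.symm
    w_i := B.extUnit_snd P.p
    w_m := by
      change (P.pair ≫ B.extMul P.p) ≫ pullback.snd _ _ = _
      rw [Category.assoc, extMul_snd, ← Category.assoc]
      congr 1
      apply TGraph.hom_ext₂
      · rw [Category.assoc, extToA₂_d₁, reassoc_of% @pair_fst]
        exact (B.lift₂_d₁ _ _ _).symm
      · rw [Category.assoc, extToA₂_c₁, pair_snd]
        exact (B.lift₂_c₁ _ _ _).symm }

theorem proj_perf : Perf T P.proj := IsPullback.of_hasPullback _ _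

end ExtAlgebra

/-! ### Comparison of a `T`-functor with the free action -/

section Compare

variable {A B Q : TCat T}

/-- The morphism `(d₀, f₁) : A₁ ⟶ T A₀ ×_{T B₀} B₁`, an isomorphism exactly when `f` is perfect. -/
noncomputable def cmp (f : A ⟶ B) : A.A₁ ⟶ B.ext (ob f) :=
  pullback.lift A.d₀ (mor f) (toGraphHom f).w_d.symm

theorem cmp_fst (f : A ⟶ B) : cmp f ≫ pullback.fst _ _ = A.d₀ := pullback.lift_fst _ _ _

theorem cmp_snd (f : A ⟶ B) : cmp f ≫ pullback.snd _ _ = mor f := pullback.lift_snd _ _ _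

theorem cmp_extHom (f : A ⟶ B) : cmp f ≫ B.extHom (ob f) = A.c₀ ≫ ob f := by
  rw [reassoc_of% @cmp_snd, (toGraphHom f).w_c]

/-- The morphism `k` is the extension of `(d₀, f₁) : A₁ ⟶ T A₀ ×_{T B₀} B₁` to a morphism of free
actions. -/
theorem k_eq (f : A ⟶ B) : k f = B.extMap (cmp f) (cmp_extHom f) ≫ B.extMul (ob f) := by
  apply pullback.hom_ext
  · rw [Category.assoc, extMul_fst, reassoc_of% @extMap_fst, ← T.map_comp_assoc, cmp_fst]
    exact pullback.lift_fst _ _ _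
  · rw [Category.assoc, extMul_snd, ← Category.assoc]
    refine (pullback.lift_snd _ _ _).trans ?_
    congr 1
    apply TGraph.hom_ext₂
    · rw [Category.assoc, extToA₂_d₁, reassoc_of% @extMap_fst, ← T.map_comp, cmp_snd]
      exact B.lift₂_d₁ _ _ _
    · rw [Category.assoc, extToA₂_c₁, extMap_snd]
      exact B.lift₂_c₁ _ _ _

theorem l_eq (f : A ⟶ B) : l f = B.extMap A.c₀ rfl := rfl

theorem e_eq (f : A ⟶ B) : e f = B.extUnit (ob f) := rfl

/-- On the generators `A₁` of the free action, `k` is `(d₀, f₁)`. -/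
theorem extUnit_k (f : A ⟶ B) : B.extUnit (A.c₀ ≫ ob f) ≫ k f = cmp f := by
  rw [k_eq, ← reassoc_of% @extUnit_naturality, extUnit_extMul]
  exact Category.comp_id _

theorem isReflexivePair_k_l (f : A ⟶ B) : IsReflexivePair (k f) (l f) := by
  have hi : A.i ≫ A.c₀ ≫ ob f = ob f := by rw [← Category.assoc, A.i_c₀, Category.id_comp]
  have hcmp : A.i ≫ cmp f = B.extUnit (ob f) := by
    apply pullback.hom_ext
    · rw [Category.assoc, cmp_fst, extUnit_fst, A.i_d₀]
    · rw [Category.assoc, cmp_snd, extUnit_snd]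
      exact Hom.w_i f
  refine IsReflexivePair.mk' (B.extMap A.i hi) ?_ ?_
  · rw [k_eq, reassoc_of% @extMap_comp, extMap_congr B hcmp, extMap_extUnit_extMul]
  · rw [l_eq, extMap_comp, extMap_congr B A.i_c₀, extMap_id]

theorem k_extHom (f : A ⟶ B) : k f ≫ B.extHom (ob f) = B.extHom (A.c₀ ≫ ob f) := by
  rw [k_eq, Category.assoc, extMul_extHom, extMap_extHom]

theorem l_extHom (f : A ⟶ B) : l f ≫ B.extHom (ob f) = B.extHom (A.c₀ ≫ ob f) := by
  rw [l_eq, extMap_extHom]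

/-- The morphism `k` commutes with the actions of `B` on the free actions. -/
theorem extMap_k_extMul (f : A ⟶ B) :
    B.extMap (k f) (k_extHom f) ≫ B.extMul (ob f) = B.extMul (A.c₀ ≫ ob f) ≫ k f := by
  rw [extMap_congr B (k_eq f), ← extMap_comp B _ (B.extMap_extHom _ _) _ (B.extMul_extHom _),
    Category.assoc, extMul_assoc, reassoc_of% @extMul_naturality, ← k_eq]

theorem extMap_l_extMul (f : A ⟶ B) :
    B.extMap (l f) (l_extHom f) ≫ B.extMul (ob f) = B.extMul (A.c₀ ≫ ob f) ≫ l f :=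
  B.extMul_naturality A.c₀ rfl

end Compare

/-! ### Perfect `T`-functors as actions -/

section Perfect

variable {A B Q : TCat T} {q : Q ⟶ B} (hq : Perf T q)

/-- The inverse `T Q₀ ×_{T B₀} B₁ ⟶ Q₁` of `cmp q` for a perfect `q : Q ⟶ B`. -/
noncomputable def ofExt : B.ext (ob q) ⟶ Q.A₁ :=
  IsPullback.lift hq (pullback.fst _ _) (pullback.snd _ _) pullback.condition

theorem ofExt_d₀ : ofExt hq ≫ Q.d₀ = pullback.fst _ _ := IsPullback.lift_fst hq _ _ _

theorem ofExt_mor : ofExt hq ≫ mor q = pullback.snd _ _ := IsPullback.lift_snd hq _ _ _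

/-- The morphism `T Q₀ ×_{T B₀} B₁ ≅ Q₁ ⟶ Q₀` by which `B` acts on a perfect `q : Q ⟶ B`. -/
noncomputable def act : B.ext (ob q) ⟶ Q.A₀ := ofExt hq ≫ Q.c₀

theorem act_ob : act hq ≫ ob q = B.extHom (ob q) := by
  rw [act, Category.assoc, ← (toGraphHom q).w_c, reassoc_of% @ofExt_mor]

theorem extUnit_act : B.extUnit (ob q) ≫ act hq = 𝟙 Q.A₀ := by
  have h : B.extUnit (ob q) ≫ ofExt hq = Q.i := by
    apply IsPullback.hom_ext hq
    · rw [Category.assoc, ofExt_d₀, extUnit_fst, Q.i_d₀]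
    · rw [Category.assoc, ofExt_mor, extUnit_snd]
      exact (Hom.w_i q).symm
  rw [act, reassoc_of% h, Q.i_c₀]

theorem extMap_act_act :
    B.extMap (act hq) (act_ob hq) ≫ act hq = B.extMul (ob q) ≫ act hq := by
  -- The composable pair in `Q` lifting the pair in `B` has the action along `extMul` as composite.
  let ψ : B.ext (B.extHom (ob q)) ⟶ Q.A₂ :=
    Q.lift₂ (pullback.fst _ _ ≫ T.map (ofExt hq)) (B.extMap (act hq) (act_ob hq) ≫ ofExt hq) (by
      rw [Category.assoc, ← T.map_comp, Category.assoc, ofExt_d₀, extMap_fst]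
      rfl)
  have hd : ψ ≫ Q.d₁ = pullback.fst _ _ ≫ T.map (ofExt hq) := Q.lift₂_d₁ _ _ _
  have hc : ψ ≫ Q.c₁ = B.extMap (act hq) (act_ob hq) ≫ ofExt hq := Q.lift₂_c₁ _ _ _
  have hψ : ψ ≫ (toGraphHom q).f₂ = B.extToA₂ (ob q) := by
    apply TGraph.hom_ext₂
    · rw [Category.assoc, TGraph.Hom.f₂_d₁, reassoc_of% hd, extToA₂_d₁, ← T.map_comp, ofExt_mor]
    · rw [Category.assoc, TGraph.Hom.f₂_c₁, reassoc_of% hc, extToA₂_c₁, ofExt_mor, extMap_snd]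
  have hm : ψ ≫ Q.m = B.extMul (ob q) ≫ ofExt hq := by
    apply IsPullback.hom_ext hq
    · rw [Category.assoc, Category.assoc, ofExt_d₀, extMul_fst, Q.m_d₀, reassoc_of% hd,
        ← T.map_comp_assoc, ofExt_d₀]
    · have hw : Q.m ≫ mor q = (toGraphHom q).f₂ ≫ B.m := Hom.w_m q
      rw [Category.assoc, Category.assoc, ofExt_mor, extMul_snd, hw, reassoc_of% hψ]
  change _ ≫ ofExt hq ≫ Q.c₀ = _ ≫ ofExt hq ≫ Q.c₀
  rw [← Category.assoc, ← hc, Category.assoc, ← Q.m_c₀, reassoc_of% hm]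

theorem cmp_extMap_ofExt {f : A ⟶ B} (h : A ⟶ Q) (w : h ≫ q = f) :
    cmp f ≫ B.extMap (ob h) (congrArg ob w) ≫ ofExt hq = mor h := by
  apply IsPullback.hom_ext hq
  · rw [Category.assoc, Category.assoc, ofExt_d₀, extMap_fst, reassoc_of% @cmp_fst,
      (toGraphHom h).w_d]
  · rw [Category.assoc, Category.assoc, ofExt_mor, extMap_snd, cmp_snd, ← w]
    rfl

/-- A `T`-functor over `B` into a perfect one is compatible on objects with the actions of the
arrows of `A`. -/
theorem cmp_extMap_act {f : A ⟶ B} (h : A ⟶ Q) (w : h ≫ q = f) :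
    cmp f ≫ B.extMap (ob h) (congrArg ob w) ≫ act hq = A.c₀ ≫ ob h := by
  refine Eq.trans ?_ (toGraphHom h).w_c
  change _ = mor h ≫ _
  rw [← cmp_extMap_ofExt hq h w, act, Category.assoc, Category.assoc]

/-- A `T`-functor over `B` into a perfect one is determined by its object part. -/
theorem hom_ext_of_perf {q : Q ⟶ B} (hq : Perf T q) {h h' : A ⟶ Q} (w : h ≫ q = h' ≫ q)
    (e : ob h = ob h') : h = h' := by
  have hm : mor h = mor h' := by
    rw [← cmp_extMap_ofExt hq h rfl, ← cmp_extMap_ofExt hq h' w.symm, extMap_congr B e]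
  exact Hom.ext e hm

/-- A morphism on objects over `B` that is compatible with the actions of the arrows of `A` extends
to a `T`-functor into a perfect `q : Q ⟶ B`. -/
noncomputable def homOfOb (f : A ⟶ B) (g : A.A₀ ⟶ Q.A₀) (w : g ≫ ob q = ob f)
    (hg : cmp f ≫ B.extMap g w ≫ act hq = A.c₀ ≫ g) : A ⟶ Q :=
  have hd : (cmp f ≫ B.extMap g w ≫ ofExt hq) ≫ Q.d₀ = A.d₀ ≫ T.map g := by
    rw [Category.assoc, Category.assoc, ofExt_d₀, extMap_fst, reassoc_of% @cmp_fst]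
  have hmor : (cmp f ≫ B.extMap g w ≫ ofExt hq) ≫ mor q = mor f := by
    rw [Category.assoc, Category.assoc, ofExt_mor, extMap_snd, cmp_snd]
  let G : TGraph.Hom A.toTGraph Q.toTGraph :=
    { f₀ := g
      f₁ := cmp f ≫ B.extMap g w ≫ ofExt hq
      w_d := hd
      w_c := by rw [← hg, act, Category.assoc, Category.assoc] }
  show TCat.Hom _ _ from
  { toHom := G
    w_i := by
      apply IsPullback.hom_ext hq
      · have hη : T.η.app A.A₀ ≫ T.map g = g ≫ T.η.app Q.A₀ := (T.η.naturality g).symm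
        rw [Category.assoc, hd, reassoc_of% A.i_d₀, Category.assoc, Q.i_d₀, hη]
      · have hf : A.i ≫ mor f = ob f ≫ B.i := Hom.w_i f
        have hqi : Q.i ≫ mor q = ob q ≫ B.i := Hom.w_i q
        rw [Category.assoc, hmor, Category.assoc, hqi, reassoc_of% w, hf]
    w_m := by
      apply IsPullback.hom_ext hq
      · have hμ : T.μ.app A.A₀ ≫ T.map g = T.map (T.map g) ≫ T.μ.app Q.A₀ :=
          (T.μ.naturality g).symm
        rw [Category.assoc, hd, reassoc_of% A.m_d₀, hμ, Category.assoc, Q.m_d₀,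
          reassoc_of% G.f₂_d₁, ← T.map_comp_assoc, ← T.map_comp_assoc, hd]
      · have hf : A.m ≫ mor f = (toGraphHom f).f₂ ≫ B.m := Hom.w_m f
        have hqm : Q.m ≫ mor q = (toGraphHom q).f₂ ≫ B.m := Hom.w_m q
        rw [Category.assoc, hmor, hf, Category.assoc, hqm, ← Category.assoc]
        congr 1
        apply TGraph.hom_ext₂
        · rw [Category.assoc, TGraph.Hom.f₂_d₁, TGraph.Hom.f₂_d₁, reassoc_of% G.f₂_d₁,
            ← T.map_comp, hmor]
        · rw [Category.assoc, TGraph.Hom.f₂_c₁, TGraph.Hom.f₂_c₁, reassoc_of% G.f₂_c₁, hmor] }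

theorem homOfOb_comp (f : A ⟶ B) (g : A.A₀ ⟶ Q.A₀) (w : g ≫ ob q = ob f)
    (hg : cmp f ≫ B.extMap g w ≫ act hq = A.c₀ ≫ g) : homOfOb hq f g w hg ≫ q = f := by
  refine Hom.ext w ?_
  change (cmp f ≫ B.extMap g w ≫ ofExt hq) ≫ mor q = mor f
  rw [Category.assoc, Category.assoc, ofExt_mor, extMap_snd, cmp_snd]

end Perfect

end TCat

/-! ### The perfect reflection -/

namespace TCat

section Reflection

variable {C : Type u} [Category.{v} C] [HasPullbacks C] [HasReflexiveCoequalizers C] {T : Monad C}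
  {A B Q : TCat T} (f : A ⟶ B)

instance hasCoequalizer_k_l : HasCoequalizer (k f) (l f) :=
  have := isReflexivePair_k_l f
  inferInstance

/-- The object part of the perfect reflection of `f`. -/
noncomputable abbrev reflOb : C := coequalizer (k f) (l f)

/-- The quotient map from the free action on `A₀`. -/
noncomputable abbrev reflπ : B.ext (ob f) ⟶ reflOb f := coequalizer.π (k f) (l f)

/-- The object part of the projection to `B` of the perfect reflection of `f`. -/
noncomputable def reflP : reflOb f ⟶ B.A₀ :=
  coequalizer.desc (B.extHom (ob f)) ((k_extHom f).trans (l_extHom f).symm)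

theorem reflπ_reflP : reflπ f ≫ reflP f = B.extHom (ob f) := coequalizer.π_desc _ _

theorem extMap_reflπ_isColimit (hC : ReflexiveCoequalizersStable C)
    (hT : Monad.PreservesColimitOfIsReflexivePair T.toFunctor) :
    ∃ w : B.extMap (k f) (k_extHom f) ≫ B.extMap (reflπ f) (reflπ_reflP f) =
        B.extMap (l f) (l_extHom f) ≫ B.extMap (reflπ f) (reflπ_reflP f),
      Nonempty (IsColimit (Cofork.ofπ (B.extMap (reflπ f) (reflπ_reflP f)) w)) :=
  B.extMap_isColimit hC hT (isReflexivePair_k_l f) (coequalizer.condition _ _)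
    ⟨coequalizerIsCoequalizer _ _⟩ _ _ _

theorem epi_extMap_reflπ (hC : ReflexiveCoequalizersStable C)
    (hT : Monad.PreservesColimitOfIsReflexivePair T.toFunctor) :
    Epi (B.extMap (reflπ f) (reflπ_reflP f)) := by
  obtain ⟨w, ⟨h⟩⟩ := extMap_reflπ_isColimit f hC hT
  exact epi_of_isColimit_cofork h

theorem epi_extMap_extMap_reflπ (hC : ReflexiveCoequalizersStable C)
    (hT : Monad.PreservesColimitOfIsReflexivePair T.toFunctor) :
    Epi (B.extMap (B.extMap (reflπ f) (reflπ_reflP f)) (B.extMap_extHom _ _)) := by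
  obtain ⟨w, h⟩ := extMap_reflπ_isColimit f hC hT
  obtain ⟨s, hs, hs'⟩ := (isReflexivePair_k_l f).common_section'
  have hp : s ≫ B.extHom (A.c₀ ≫ ob f) = B.extHom (ob f) := by
    rw [← k_extHom, ← Category.assoc, hs, Category.id_comp]
  have hr : IsReflexivePair (B.extMap (k f) (k_extHom f)) (B.extMap (l f) (l_extHom f)) :=
    IsReflexivePair.mk' (B.extMap s hp)
      (by rw [extMap_comp, extMap_congr B hs, extMap_id])
      (by rw [extMap_comp, extMap_congr B hs', extMap_id])
  obtain ⟨w', ⟨h'⟩⟩ := B.extMap_isColimit hC hT hr w h (B.extMap_extHom _ _) (B.extMap_extHom _ _)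
    (B.extMap_extHom _ _)
  exact epi_of_isColimit_cofork h'

/-- The multiplication of the free action descends along the quotient map, because the free action
preserves the coequalizer and `k` and `l` are morphisms of free actions. -/
theorem exists_reflAct (hC : ReflexiveCoequalizersStable C)
    (hT : Monad.PreservesColimitOfIsReflexivePair T.toFunctor) :
    ∃ a : B.ext (reflP f) ⟶ reflOb f,
      B.extMap (reflπ f) (reflπ_reflP f) ≫ a = B.extMul (ob f) ≫ reflπ f := by
  obtain ⟨w, ⟨h⟩⟩ := extMap_reflπ_isColimit f hC hT
  obtain ⟨a, ha⟩ := Cofork.IsColimit.desc' h (B.extMul (ob f) ≫ reflπ f) (by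
    rw [reassoc_of% extMap_k_extMul f, reassoc_of% extMap_l_extMul f, coequalizer.condition])
  exact ⟨a, ha⟩

variable (hC : ReflexiveCoequalizersStable C)
  (hT : Monad.PreservesColimitOfIsReflexivePair T.toFunctor)

/-- The action of `B` on the object part of the perfect reflection. -/
noncomputable def reflAct : B.ext (reflP f) ⟶ reflOb f := (exists_reflAct f hC hT).choose

theorem extMap_reflAct :
    B.extMap (reflπ f) (reflπ_reflP f) ≫ reflAct f hC hT = B.extMul (ob f) ≫ reflπ f :=
  (exists_reflAct f hC hT).choose_spec

theorem reflAct_reflP : reflAct f hC hT ≫ reflP f = B.extHom (reflP f) := by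
  have := epi_extMap_reflπ f hC hT
  rw [← cancel_epi (B.extMap (reflπ f) (reflπ_reflP f)), reassoc_of% @extMap_reflAct, reflπ_reflP,
    extMul_extHom, extMap_extHom]

/-- The coequalizer of `k` and `l`, as a `B`-action. -/
noncomputable def reflAlgebra : ExtAlgebra B where
  X := reflOb f
  p := reflP f
  a := reflAct f hC hT
  a_p := reflAct_reflP f hC hT
  unit := by
    rw [← cancel_epi (reflπ f), reassoc_of% (B.extUnit_naturality (reflπ f) (reflπ_reflP f)),
      extMap_reflAct, reassoc_of% @extUnit_extMul, Category.comp_id]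
  assoc := by
    have := epi_extMap_extMap_reflπ f hC hT
    rw [← cancel_epi (B.extMap (B.extMap (reflπ f) (reflπ_reflP f)) (B.extMap_extHom _ _)),
      reassoc_of% @extMul_naturality, extMap_reflAct, ← reassoc_of% @extMul_assoc,
      ← extMap_reflAct f hC hT,
      reassoc_of% @extMap_comp, extMap_congr B (extMap_reflAct f hC hT),
      ← reassoc_of% (B.extMap_comp _ (B.extMul_extHom _) _ (reflπ_reflP f))]

/-- The domain of the perfect reflection of `f`. -/
noncomputable abbrev refl : TCat T := (reflAlgebra f hC hT).toTCat

/-- The perfect reflection of `f`, as a `T`-functor to `B`. -/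
noncomputable abbrev reflProj : refl f hC hT ⟶ B := (reflAlgebra f hC hT).proj

theorem reflProj_perf : Perf T (reflProj f hC hT) := (reflAlgebra f hC hT).proj_perf

theorem act_reflProj : act (reflProj_perf f hC hT) = reflAct f hC hT := by
  have h : ofExt (reflProj_perf f hC hT) = 𝟙 _ :=
    pullback.hom_ext ((ofExt_d₀ (reflProj_perf f hC hT)).trans (Category.id_comp _).symm)
      ((ofExt_mor (reflProj_perf f hC hT)).trans (Category.id_comp _).symm)
  rw [act, h]
  exact Category.id_comp _

theorem cmp_reflProj : cmp (reflProj f hC hT) = 𝟙 _ :=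
  pullback.hom_ext ((cmp_fst (reflProj f hC hT)).trans (Category.id_comp _).symm)
    ((cmp_snd (reflProj f hC hT)).trans (Category.id_comp _).symm)

theorem e_reflP : (e f ≫ reflπ f) ≫ reflP f = ob f := by
  rw [Category.assoc, reflπ_reflP, e_eq, extUnit_extHom]

/-- The quotient map is the action of `B` on the images of the generators `A₀`. -/
theorem extMap_e_reflAct :
    B.extMap (e f ≫ reflπ f) (e_reflP f) ≫ reflAct f hC hT = reflπ f := by
  rw [← B.extMap_comp (e f) (B.extUnit_extHom _) (reflπ f) (reflπ_reflP f), Category.assoc,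
    extMap_reflAct]
  exact (reassoc_of% (B.extMap_extUnit_extMul (ob f))) (reflπ f)

/-- The unit of the perfect reflection. It is a `T`-functor because the two legs of the coequalizer
agree on the generators `A₁` of `T A₁ ×_{T B₀} B₁`. -/
noncomputable def reflUnit : A ⟶ refl f hC hT :=
  homOfOb (reflProj_perf f hC hT) f (e f ≫ reflπ f) (e_reflP f) (by
    rw [act_reflProj]
    refine (congrArg (cmp f ≫ ·) (extMap_e_reflAct f hC hT)).trans ?_
    rw [← extUnit_k f, Category.assoc, coequalizer.condition]
    exact ((reassoc_of% (B.extUnit_naturality A.c₀ rfl)) (reflπ f)).symm)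

theorem reflUnit_reflProj : reflUnit f hC hT ≫ reflProj f hC hT = f := homOfOb_comp _ _ _ _ _

section Desc

variable {f} {q : Q ⟶ B} (hq : Perf T q) (h : A ⟶ Q) (w : h ≫ q = f)

/-- A `T`-functor over `B` into a perfect one, extended to the coequalizer. -/
noncomputable def reflDescOb : reflOb f ⟶ Q.A₀ :=
  coequalizer.desc (B.extMap (ob h) (congrArg ob w) ≫ act hq) (by
    have hw : ob h ≫ ob q = ob f := congrArg ob w
    rw [k_eq, Category.assoc, ← reassoc_of% (B.extMul_naturality (ob h) hw), ← extMap_act_act,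
      reassoc_of% @extMap_comp, reassoc_of% @extMap_comp, l_eq, reassoc_of% @extMap_comp]
    congr 1
    apply extMap_congr
    rw [Category.assoc]
    exact cmp_extMap_act hq h w)

theorem reflπ_reflDescOb :
    reflπ f ≫ reflDescOb hq h w = B.extMap (ob h) (congrArg ob w) ≫ act hq :=
  coequalizer.π_desc _ _

theorem reflDescOb_ob : reflDescOb hq h w ≫ ob q = reflP f := by
  rw [← cancel_epi (reflπ f), reassoc_of% @reflπ_reflDescOb, act_ob, extMap_extHom, reflπ_reflP]

theorem extMap_reflDescOb_act :
    B.extMap (reflDescOb hq h w) (reflDescOb_ob hq h w) ≫ act hq =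
      reflAct f hC hT ≫ reflDescOb hq h w := by
  have := epi_extMap_reflπ f hC hT
  have hw : ob h ≫ ob q = ob f := congrArg ob w
  rw [← cancel_epi (B.extMap (reflπ f) (reflπ_reflP f)), reassoc_of% @extMap_reflAct,
    reflπ_reflDescOb,
    ← reassoc_of% (B.extMul_naturality (ob h) hw), ← extMap_act_act, reassoc_of% @extMap_comp,
    reassoc_of% @extMap_comp]
  congr 1
  exact extMap_congr B (reflπ_reflDescOb hq h w) _

/-- The factorization through the perfect reflection of a `T`-functor over `B` into a perfect
one. -/
noncomputable def reflDesc : refl f hC hT ⟶ Q :=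
  homOfOb hq (reflProj f hC hT) (reflDescOb hq h w) (reflDescOb_ob hq h w) (by
    rw [cmp_reflProj]
    exact (Category.id_comp _).trans (extMap_reflDescOb_act hC hT hq h w))

theorem reflDesc_comp : reflDesc hC hT hq h w ≫ q = reflProj f hC hT := homOfOb_comp _ _ _ _ _

theorem reflUnit_reflDesc : reflUnit f hC hT ≫ reflDesc hC hT hq h w = h := by
  apply hom_ext_of_perf hq
  · rw [Category.assoc, reflDesc_comp, reflUnit_reflProj, w]
  · change (e f ≫ reflπ f) ≫ reflDescOb hq h w = ob h
    have hw : ob h ≫ ob q = ob f := congrArg ob w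
    rw [Category.assoc, reflπ_reflDescOb, e_eq, ← reassoc_of% (B.extUnit_naturality (ob h) hw),
      extUnit_act, Category.comp_id]

theorem eq_reflDesc (g : refl f hC hT ⟶ Q) (hg : g ≫ q = reflProj f hC hT)
    (hu : reflUnit f hC hT ≫ g = h) : g = reflDesc hC hT hq h w := by
  apply hom_ext_of_perf hq
  · rw [hg, reflDesc_comp]
  · let g₀ : reflOb f ⟶ Q.A₀ := ob g
    have hg₀ : g₀ ≫ ob q = reflP f := congrArg ob hg
    have hu₀ : (e f ≫ reflπ f) ≫ g₀ = ob h := congrArg ob hu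
    have ha : B.extMap g₀ hg₀ ≫ act hq = reflAct f hC hT ≫ g₀ := by
      have hc := cmp_extMap_act hq g hg
      rw [cmp_reflProj] at hc
      exact (Category.id_comp _).symm.trans hc
    change g₀ = reflDescOb hq h w
    rw [← cancel_epi (reflπ f), reflπ_reflDescOb,
      ← extMap_congr B hu₀ (by rw [Category.assoc, hg₀, e_reflP]),
      ← B.extMap_comp _ (e_reflP f) g₀ hg₀, Category.assoc, ha, ← Category.assoc, extMap_e_reflAct]

end Desc

/-! ### Reflectivity -/

variable (B)

/-- The perfect reflection of an object of `Cat(T)/B`. -/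
noncomputable def perfObj (X : Over B) : (PerfOver B).FullSubcategory :=
  ⟨Over.mk (reflProj X.hom hC hT), reflProj_perf X.hom hC hT⟩

/-- The universal property of the perfect reflection. -/
noncomputable def perfEquiv (X : Over B) (Y : (PerfOver B).FullSubcategory) :
    (perfObj B hC hT X ⟶ Y) ≃ (X ⟶ (PerfOver B).ι.obj Y) where
  toFun g := Over.homMk (reflUnit X.hom hC hT ≫ g.hom.left) (by
    have hg : g.hom.left ≫ Y.obj.hom = reflProj X.hom hC hT := Over.w g.hom
    refine (Category.assoc _ _ _).trans ?_
    exact (congrArg (reflUnit X.hom hC hT ≫ ·) hg).trans (reflUnit_reflProj _ _ _))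
  invFun g := ObjectProperty.homMk (Over.homMk
    (reflDesc hC hT Y.property g.left (Over.w g)) (reflDesc_comp hC hT Y.property _ _))
  left_inv g := by
    apply ObjectProperty.hom_ext
    apply Over.OverMorphism.ext
    exact (eq_reflDesc hC hT Y.property _ _ g.hom.left (Over.w g.hom) rfl).symm
  right_inv g := by
    apply Over.OverMorphism.ext
    exact reflUnit_reflDesc hC hT Y.property _ _

theorem perfEquiv_naturality (X : Over B) (Y Y' : (PerfOver B).FullSubcategory) (g : Y ⟶ Y')
    (h : perfObj B hC hT X ⟶ Y) :
    perfEquiv B hC hT X Y' (h ≫ g) = perfEquiv B hC hT X Y h ≫ (PerfOver B).ι.map g := by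
  apply Over.OverMorphism.ext
  exact (Category.assoc _ _ _).symm

/-- Perfect `T`-functors over `B` are reflective in `Cat(T)/B`. -/
@[reducible]
noncomputable def perfReflective : Reflective (PerfOver B).ι where
  L := Adjunction.leftAdjointOfEquiv (perfEquiv B hC hT) (perfEquiv_naturality B hC hT)
  adj := Adjunction.adjunctionOfEquivLeft (perfEquiv B hC hT) (perfEquiv_naturality B hC hT)

theorem perfReflective_unit (X : Over B) :
    ((perfReflective B hC hT).adj.unit.app X).left = reflUnit X.hom hC hT :=
  (congrArg CommaMorphism.left (Adjunction.adjunctionOfEquivLeft_unit_app (perfEquiv B hC hT)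
    (perfEquiv_naturality B hC hT) X)).trans (Category.comp_id _)

end Reflection

end TCat

theorem mainTheorem2 {C : Type u} [Category.{v} C] [HasPullbacks C] [HasReflexiveCoequalizers C]
    (hC : ReflexiveCoequalizersStable C)
    (T : Monad C) (hT : Monad.PreservesColimitOfIsReflexivePair T.toFunctor)
    (B : TCat T) :
    ∃ R : Reflective (TCat.PerfOver B).ι,
      ∀ X : Over B,
        ∃ (z : TCat.Obj₀ X.hom ⟶ (R.L.obj X).obj.left.A₀)
          (w : TCat.k X.hom ≫ z = TCat.l X.hom ≫ z),
          Nonempty (IsColimit (Cofork.ofπ z w)) ∧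
          z ≫ TCat.ob (R.L.obj X).obj.hom = pullback.snd _ _ ≫ B.c₀ ∧
          TCat.ob (R.adj.unit.app X).left = TCat.e X.hom ≫ z := by
  refine ⟨TCat.perfReflective B hC hT, fun X => ⟨TCat.reflπ X.hom, coequalizer.condition _ _,
    ⟨coequalizerIsCoequalizer _ _⟩, TCat.reflπ_reflP X.hom, ?_⟩⟩
  rw [TCat.perfReflective_unit]
  rfl
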